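/- Let $\langle\cdot,\cdot\rangle$ be a nondegenerate symmetric $\mathbb{C}$-bilinear form on $\mathbb{C}^5$, and let $\mathbb{Q}^3=\{[w]\in\mathbb{P}(\mathbb{C}^5)=\mathbb{P}^4 : \langle w,w\rangle=0\}$ be its null hyperquadric. A holomorphic map $g:\mathbb{P}^1\to\mathbb{P}^4$, written locally as $g=[G]$ with $G$ a nonvanishing holomorphic $\mathbb{C}^5$-valued function of a local coordinate, is called a *null curve* in $\mathbb{Q}^3$ if $g(\mathbb{P}^1)\subset\mathbb{Q}^3$ and the tangent lines of $g$ lie in $\mathbb{Q}^3$, i.e. $\langle G,G\rangle=\langle G,G'\rangle=\langle G',G'\rangle=0$. It is *nonlinear* if $g(\mathbb{P}^1)$ is not contained in a projective line of $\mathbb{P}^4$, and *unbranched* if it is an immersion. Its *degree* is the number of points of $g^{-1}(H)$ for any hyperplane $H\subset\mathbb{P}^4$ that is nowhere tangent to $g$. **Proposition.** There is no unbranched nonlinear null curve $g:\mathbb{P}^1\to\mathbb{Q}^3$ of degree $7$. -/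

import Mathlib

open scoped LinearAlgebra.Projectivization Topology

/-- The Riemann sphere, as the complex projective line. -/
abbrev ProjLine : Type := ℙ ℂ (Fin 2 → ℂ)

theorem affinePoint_ne_zero (i : Fin 2) (z : ℂ) :
    (Function.update (fun _ => z) i 1 : Fin 2 → ℂ) ≠ 0 := by
  intro h
  have h' := congrFun h i
  simp at h'

/-- The two standard affine parametrizations of the Riemann sphere:
`affineParam 0 z = [1 : z]` and `affineParam 1 z = [z : 1]`. Their inverses form the standard
holomorphic atlas. -/
noncomputable def affineParam (i : Fin 2) (z : ℂ) : ProjLine :=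
  Projectivization.mk ℂ (Function.update (fun _ => z) i 1) (affinePoint_ne_zero i z)

namespace ProjCurve

variable {V : Type*} [NormedAddCommGroup V] [NormedSpace ℂ V]

/-- `G` is a nonvanishing holomorphic lift of `g` to `V` near the point `affineParam i z₀`,
written in the `i`-th affine coordinate: `g = [G]` there. -/
structure IsLocalLift (g : ProjLine → ℙ ℂ V) (i : Fin 2) (z₀ : ℂ) (G : ℂ → V) : Prop where
  analyticAt : AnalyticAt ℂ G z₀
  ne_zero : G z₀ ≠ 0
  eq_mk : ∀ᶠ z in 𝓝 z₀, ∃ h : G z ≠ 0, g (affineParam i z) = Projectivization.mk ℂ (G z) h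

/-- `g : ℙ¹ → ℙ(V)` is holomorphic: around each point it is `[G]` for a nonvanishing holomorphic
`V`-valued function `G` of an affine coordinate. -/
def IsHolomorphic (g : ProjLine → ℙ ℂ V) : Prop :=
  ∀ (i : Fin 2) (z₀ : ℂ), ∃ G : ℂ → V, IsLocalLift g i z₀ G

/-- The image of `g` is contained in a projective line of `ℙ(V)`, that is, in the projectivization
of a `2`-dimensional linear subspace. -/
def IsLinear (g : ProjLine → ℙ ℂ V) : Prop :=
  ∃ L : Submodule ℂ V, Module.finrank ℂ L = 2 ∧ ∀ p, (g p).submodule ≤ L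

/-- `g` is unbranched, i.e. an immersion: the differential of `g = [G]` is injective at a point
exactly when `G` and `G'` are linearly independent there. -/
def IsUnbranched (g : ProjLine → ℙ ℂ V) : Prop :=
  ∀ (i : Fin 2) (z₀ : ℂ) (G : ℂ → V), IsLocalLift g i z₀ G →
    LinearIndependent ℂ ![G z₀, deriv G z₀]

/-- The hyperplane `{φ = 0}` of `ℙ(V)` is nowhere tangent to `g`: whenever it passes through a
point of `g`, the function `φ ∘ G` has a simple zero there. -/
def NowhereTangent (g : ProjLine → ℙ ℂ V) (φ : V →ₗ[ℂ] ℂ) : Prop :=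
  φ ≠ 0 ∧ ∀ (i : Fin 2) (z₀ : ℂ) (G : ℂ → V), IsLocalLift g i z₀ G →
    φ (G z₀) = 0 → φ (deriv G z₀) ≠ 0

/-- The degree of the curve `g` is `d`: the preimage of a hyperplane that is nowhere tangent to `g`
consists of exactly `d` points. (The number of points does not depend on the choice of the nowhere
tangent hyperplane.) -/
def HasDegree (g : ProjLine → ℙ ℂ V) (d : ℕ) : Prop :=
  ∃ φ : V →ₗ[ℂ] ℂ, NowhereTangent g φ ∧
    {p : ProjLine | (g p).submodule ≤ LinearMap.ker φ}.encard = d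

/-- The null hyperquadric `{[v] : B(v, v) = 0}` in `ℙ(V)` of a bilinear form `B`. -/
def nullQuadric (B : LinearMap.BilinForm ℂ V) : Set (ℙ ℂ V) :=
  {x | ∀ v ∈ x.submodule, B v v = 0}

/-- `g` is a null curve in the null hyperquadric of the symmetric form `B`: it is holomorphic, takes
values in the hyperquadric, and its tangent lines (the projectivizations of the spans of `G` and
`G'`) are contained in the hyperquadric. -/
structure IsNullCurve (B : LinearMap.BilinForm ℂ V) (g : ProjLine → ℙ ℂ V) : Prop where
  holomorphic : IsHolomorphic g
  mem_nullQuadric : ∀ p, g p ∈ nullQuadric B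
  tangent_null : ∀ (i : Fin 2) (z₀ : ℂ) (G : ℂ → V), IsLocalLift g i z₀ G →
    ∀ v ∈ Submodule.span ℂ {G z₀, deriv G z₀}, B v v = 0

end ProjCurve

/-! Clearing the poles of `g` along a nowhere tangent hyperplane gives a lift by a polynomial `P` of
degree at most 7 (`exists_polynomial_lift`). Since `P` and `P'` are isotropic, the symmetric kernel
`B (P z) (P w)` vanishes to order 4 on the diagonal, so it equals `(z - w) ^ 4 * M z w` with `M`
symmetric of degree at most 3 in each variable (`eq_gramCoeff_quotientCoeff`). The diagonal `M z z`
is a form of degree 6 on the projective line, proportional to `B P'' P''`.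

At a zero of `M z z` the isotropic vector `P''` is orthogonal to the isotropic plane of `P, P'`,
hence lies in it, as dimension 5 admits no isotropic 3-space. Pairing this relation with later
Taylor coefficients shows that the zero is at least double (`tangent_of_root`). A higher zero would
put the curve in a hyperplane (`tangent_of_double_root`), which is impossible once `M z z` is
nonzero somewhere (`eq_zero_of_ne_zero`).

So either `M z z` vanishes identically, and then `M = 0` and the curve is a line
(`isotropic_of_bicubic_diag`), or it has exactly three double zeros. Moved to infinity, 0 and 1,
they determine `M` up to a scalar, and the Gram determinant of two vectors orthogonal to the plane
of `P, P'` forces that scalar to be 0 (`false_of_roots`). -/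

/-! ### Isotropic planes in a five-dimensional quadratic space. -/

section BilinearAlgebra

variable {V : Type*} [AddCommGroup V] [Module ℂ V] [FiniteDimensional ℂ V]

/-- In a nondegenerate quadratic space of dimension `5` an isotropic vector orthogonal to an
isotropic plane lies in this plane. -/
theorem exists_eq_of_isotropic {B : LinearMap.BilinForm ℂ V} (hV : Module.finrank ℂ V = 5)
    (hs : B.IsSymm) (hB : B.Nondegenerate) {x y w : V} (hxy : LinearIndependent ℂ ![x, y])
    (hxx : B x x = 0) (hxy0 : B x y = 0) (hyy : B y y = 0)
    (hxw : B x w = 0) (hyw : B y w = 0) (hww : B w w = 0) :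
    ∃ s t : ℂ, w = s • x + t • y := by
  by_contra hcon
  have hli : LinearIndependent ℂ ![w, x, y] := by
    refine linearIndependent_finCons.2 ?_
    refine ⟨hxy, fun hmem => hcon ?_⟩
    have : w ∈ Submodule.span ℂ {x, y} := by
      simpa [Set.pair_comm] using hmem
    obtain ⟨s, t, h⟩ := Submodule.mem_span_pair.1 this
    exact ⟨s, t, h.symm⟩
  set W := Submodule.span ℂ (Set.range ![w, x, y]) with hW
  have hfin : Module.finrank ℂ W = 3 := by
    rw [hW, finrank_span_eq_card hli]; simp
  have hsub (a b : V) : B a b = B b a := hs.eq a b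
  -- `W` is totally isotropic of dimension 3, while its orthogonal has dimension 2.
  have hle : W ≤ B.orthogonal W := by
    rw [hW, Submodule.span_le]
    have key : ∀ i, ∀ u ∈ W, B u (![w, x, y] i) = 0 := by
      intro i u hu
      induction hu using Submodule.span_induction with
      | mem u hu =>
        obtain ⟨j, rfl⟩ := hu
        fin_cases i <;> fin_cases j <;> simp [hxx, hxy0, hyy, hxw, hyw, hww, hsub w x, hsub w y,
          hsub y x]
      | zero => simp
      | add u u' _ _ h h' => simp [h, h']
      | smul c u _ h => simp [h]
    rintro _ ⟨i, rfl⟩ u hu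
    exact key i u hu
  have h1 := LinearMap.BilinForm.finrank_orthogonal hB W
  have h2 := Submodule.finrank_mono hle
  omega

/-- In a nondegenerate quadratic space of dimension `5` two vectors orthogonal to an isotropic plane
have vanishing Gram determinant. -/
theorem gram_det_eq_zero_of_orthogonal {B : LinearMap.BilinForm ℂ V}
    (hV : Module.finrank ℂ V = 5)
    (hs : B.IsSymm) (hB : B.Nondegenerate) {x y u w : V} (hxy : LinearIndependent ℂ ![x, y])
    (hxx : B x x = 0) (hxy0 : B x y = 0) (hyy : B y y = 0)
    (hxu : B x u = 0) (hyu : B y u = 0) (hxw : B x w = 0) (hyw : B y w = 0) :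
    B u u * B w w = B u w ^ 2 := by
  have hsub (a b : V) : B a b = B b a := hs.eq a b
  by_cases huu : B u u = 0
  · obtain ⟨s, t, rfl⟩ := exists_eq_of_isotropic hV hs hB hxy hxx hxy0 hyy hxu hyu huu
    rw [huu]
    simp [hxw, hyw]
  -- `r` is a square root of the reduced discriminant of `B (α • u + w) (α • u + w)` as a quadratic
  -- in `α`. The resulting isotropic vector lies in the plane, hence is orthogonal to `u` and `w`.
  · obtain ⟨r, hr⟩ := IsAlgClosed.exists_pow_nat_eq (B u w ^ 2 - B u u * B w w) (n := 2) (by simp)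
    set α := (r - B u w) / B u u with hα
    have hαu : α * B u u = r - B u w := by rw [hα]; field_simp
    obtain ⟨s, t, h⟩ := exists_eq_of_isotropic (w := α • u + w) hV hs hB hxy hxx hxy0 hyy
      (by simp [hxu, hxw]) (by simp [hyu, hyw]) (by
        have : B (α • u + w) (α • u + w) = α * (α * B u u) + 2 * α * B u w + B w w := by
          simp [hsub w u]; ring
        rw [this, hαu]
        apply mul_left_cancel₀ huu
        linear_combination (r + B u w) * hαu + hr)
    have e1 : B u (α • u + w) = 0 := by rw [h]; simp [hsub u x, hsub u y, hxu, hyu]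
    have e2 : B w (α • u + w) = 0 := by rw [h]; simp [hsub w x, hsub w y, hxw, hyw]
    simp only [map_add, map_smul, smul_eq_mul, hsub w u] at e1 e2
    linear_combination B u u * e2 - B u w * e1

end BilinearAlgebra

/-! ### Comparison of polynomial coefficients. -/

section Coefficients

theorem coeff_eq_zero_of_forall_sum {n : ℕ} {c : ℕ → ℂ}
    (h : ∀ z : ℂ, ∑ k ∈ Finset.range n, z ^ k * c k = 0) : ∀ k < n, c k = 0 := by
  intro k hk
  have hp : (∑ k ∈ Finset.range n, Polynomial.C (c k) * Polynomial.X ^ k) = 0 := by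
    apply Polynomial.funext
    intro z
    rw [Polynomial.eval_finsetSum]
    simpa only [Polynomial.eval_mul, Polynomial.eval_C, Polynomial.eval_pow, Polynomial.eval_X,
      mul_comm (c _), Polynomial.eval_zero] using h z
  have := congrArg (fun p => Polynomial.coeff p k) hp
  simpa [Polynomial.finsetSum_coeff, Polynomial.coeff_C_mul, Polynomial.coeff_X_pow, hk] using this

/-- A polynomial function without zeros is constant. -/
theorem coeff_eq_zero_of_forall_sum_ne_zero {n : ℕ} {c : ℕ → ℂ}
    (h : ∀ z : ℂ, ∑ k ∈ Finset.range n, z ^ k * c k ≠ 0) : ∀ k < n, k ≠ 0 → c k = 0 := by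
  intro k hk hk0
  set p : Polynomial ℂ := ∑ k ∈ Finset.range n, Polynomial.C (c k) * Polynomial.X ^ k with hp
  have hev (z : ℂ) : p.eval z = ∑ k ∈ Finset.range n, z ^ k * c k := by
    rw [hp, Polynomial.eval_finsetSum]
    simp only [Polynomial.eval_mul, Polynomial.eval_C, Polynomial.eval_pow, Polynomial.eval_X,
      mul_comm (c _)]
  have hdeg : p.degree = 0 := by
    by_contra hd
    obtain ⟨z, hz⟩ := IsAlgClosed.exists_root p hd
    exact h z ((hev z).symm.trans hz)
  have hcoeff : p.coeff k = c k := by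
    simp [hp, Polynomial.finsetSum_coeff, Polynomial.coeff_C_mul, Polynomial.coeff_X_pow, hk]
  rw [← hcoeff]
  apply Polynomial.coeff_eq_zero_of_degree_lt
  rw [hdeg]
  exact_mod_cast Nat.pos_of_ne_zero hk0

end Coefficients

/-! ### Polynomial curves of degree 7, their Gram kernels and changes of coordinate. -/

section Septic

variable {V : Type*} [AddCommGroup V] [Module ℂ V]

/-- The vector-valued polynomial of degree at most `7` with coefficients `v k`. -/
def septic (v : ℕ → V) (z : ℂ) : V := ∑ k ∈ Finset.range 8, z ^ k • v k

/-- The derivative of `septic v`. -/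
def septicDeriv (v : ℕ → V) (z : ℂ) : V :=
  ∑ k ∈ Finset.range 7, (((k : ℂ) + 1) * z ^ k) • v (k + 1)

/-- The polynomial with coefficient matrix `m`, of degree at most `3` in both variables. -/
def bicubic (m : ℕ → ℕ → ℂ) (z w : ℂ) : ℂ :=
  ∑ i ∈ Finset.range 4, ∑ j ∈ Finset.range 4, m i j * z ^ i * w ^ j

/-- The coefficients of `(z - w) ^ 4 * bicubic m z w`. -/
def gramCoeff (m : ℕ → ℕ → ℂ) (i j : ℕ) : ℂ :=
  ∑ t ∈ Finset.range 5, if t ≤ i ∧ 4 - t ≤ j ∧ i - t < 4 ∧ j - (4 - t) < 4 then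
    (-1) ^ t * (Nat.choose 4 t : ℂ) * m (i - t) (j - (4 - t)) else 0

theorem sub_pow_four_mul_bicubic (m : ℕ → ℕ → ℂ) (z w : ℂ) :
    (z - w) ^ 4 * bicubic m z w =
      ∑ i ∈ Finset.range 8, z ^ i * ∑ j ∈ Finset.range 8, w ^ j * gramCoeff m i j := by
  simp [bicubic, gramCoeff, Finset.sum_range_succ, Nat.choose]
  ring

/-- A null curve of degree `7` in terms of its coefficients: the Gram kernel `B (P z) (P w)` of the
polynomial `P = septic v` is `(z - w) ^ 4` times the polynomial with symmetric coefficient matrix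
`m`, and `P` is an immersion at all points of the projective line. -/
structure IsNullSeptic (B : LinearMap.BilinForm ℂ V) (v : ℕ → V) (m : ℕ → ℕ → ℂ) : Prop where
  symm : ∀ i j, m i j = m j i
  gram : ∀ i < 8, ∀ j < 8, B (v i) (v j) = gramCoeff m i j
  indep : ∀ z, LinearIndependent ℂ ![septic v z, septicDeriv v z]
  indep_top : LinearIndependent ℂ ![v 7, v 6]

theorem apply_septic_septic (B : LinearMap.BilinForm ℂ V) (v : ℕ → V) (z w : ℂ) :
    B (septic v z) (septic v w) =
      ∑ i ∈ Finset.range 8, z ^ i * ∑ j ∈ Finset.range 8, w ^ j * B (v i) (v j) := by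
  simp only [septic, map_sum, LinearMap.sum_apply, map_smul, LinearMap.smul_apply, smul_eq_mul,
    Finset.mul_sum]
  rw [Finset.sum_comm]
  exact Finset.sum_congr rfl fun i _ => Finset.sum_congr rfl fun j _ => by ring

/-- The functional form makes the behaviour of the Gram condition under affine substitutions
immediate. -/
theorem gram_eq_iff {B : LinearMap.BilinForm ℂ V} {v : ℕ → V} {m : ℕ → ℕ → ℂ} :
    (∀ i < 8, ∀ j < 8, B (v i) (v j) = gramCoeff m i j) ↔
      ∀ z w, B (septic v z) (septic v w) = (z - w) ^ 4 * bicubic m z w := by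
  simp only [apply_septic_septic, sub_pow_four_mul_bicubic]
  constructor
  · intro h z w
    refine Finset.sum_congr rfl fun i hi => ?_
    congr 1
    refine Finset.sum_congr rfl fun j hj => ?_
    rw [h i (Finset.mem_range.1 hi) j (Finset.mem_range.1 hj)]
  · intro h i hi j hj
    have h1 (w : ℂ) : ∀ i < 8, ∑ j ∈ Finset.range 8, w ^ j * B (v i) (v j) -
        ∑ j ∈ Finset.range 8, w ^ j * gramCoeff m i j = 0 := by
      apply coeff_eq_zero_of_forall_sum
      intro z
      simp only [mul_sub, Finset.sum_sub_distrib]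
      exact sub_eq_zero.2 (h z w)
    have h2 := coeff_eq_zero_of_forall_sum
      (c := fun j => B (v i) (v j) - gramCoeff m i j) (n := 8) (fun w => by
        simp only [mul_sub, Finset.sum_sub_distrib]
        exact h1 w i hi) j hj
    exact sub_eq_zero.1 h2

/-- The coefficients of the polynomial `(l * z + r) ^ i` of `z`. -/
def affineCoeff (l r : ℂ) (i j : ℕ) : ℂ := (i.choose j : ℂ) * l ^ j * r ^ (i - j)

theorem affine_pow (l r z : ℂ) {n i : ℕ} (hi : i < n) :
    (l * z + r) ^ i = ∑ j ∈ Finset.range n, z ^ j * affineCoeff l r i j := by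
  rw [add_pow]
  have hsub : Finset.range (i + 1) ⊆ Finset.range n := by
    intro j hj
    simp only [Finset.mem_range] at *
    omega
  rw [← Finset.sum_subset hsub]
  · refine Finset.sum_congr rfl fun j _ => ?_
    rw [affineCoeff, mul_pow]
    ring
  · intro j _ hj
    have : i < j := by simpa using hj
    simp [affineCoeff, Nat.choose_eq_zero_of_lt this]

/-- The coefficients of `septic v (l * z + r)`. -/
def septicAffine (l r : ℂ) (v : ℕ → V) (j : ℕ) : V :=
  ∑ i ∈ Finset.range 8, affineCoeff l r i j • v i

theorem septic_septicAffine (l r : ℂ) (v : ℕ → V) (z : ℂ) :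
    septic (septicAffine l r v) z = septic v (l * z + r) := by
  simp only [septic, septicAffine, Finset.smul_sum, smul_smul]
  rw [Finset.sum_comm]
  refine Finset.sum_congr rfl fun i hi => ?_
  rw [affine_pow l r z (Finset.mem_range.1 hi), Finset.sum_smul]

theorem septicDeriv_septicAffine (l r : ℂ) (v : ℕ → V) (z : ℂ) :
    septicDeriv (septicAffine l r v) z = l • septicDeriv v (l * z + r) := by
  simp [septicDeriv, septicAffine, Finset.sum_range_succ, affineCoeff, Nat.choose]
  module

/-- The coefficients of `l ^ 4 * bicubic m (l * z + r) (l * w + r)`. -/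
def bicubicAffine (l r : ℂ) (m : ℕ → ℕ → ℂ) (a b : ℕ) : ℂ :=
  l ^ 4 * ∑ i ∈ Finset.range 4, ∑ j ∈ Finset.range 4,
    affineCoeff l r i a * affineCoeff l r j b * m i j

theorem bicubic_bicubicAffine (l r : ℂ) (m : ℕ → ℕ → ℂ) (z w : ℂ) :
    bicubic (bicubicAffine l r m) z w = l ^ 4 * bicubic m (l * z + r) (l * w + r) := by
  simp [bicubic, bicubicAffine, Finset.sum_range_succ, affineCoeff, Nat.choose]
  ring

theorem linearIndependent_pair_of_det {x y : V} (h : LinearIndependent ℂ ![x, y]) {a b c d : ℂ}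
    (hdet : a * d - b * c ≠ 0) : LinearIndependent ℂ ![a • x + b • y, c • x + d • y] := by
  rw [LinearIndependent.pair_iff] at h ⊢
  intro s t hst
  obtain ⟨h1, h2⟩ := h (s * a + t * c) (s * b + t * d) (by rw [← hst]; module)
  constructor
  · apply mul_left_cancel₀ hdet
    linear_combination d * h1 - c * h2
  · apply mul_left_cancel₀ hdet
    linear_combination a * h2 - b * h1

theorem IsNullSeptic.affine {B : LinearMap.BilinForm ℂ V} {v : ℕ → V} {m : ℕ → ℕ → ℂ}
    (h : IsNullSeptic B v m) {l : ℂ} (hl : l ≠ 0) (r : ℂ) :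
    IsNullSeptic B (septicAffine l r v) (bicubicAffine l r m) where
  symm i j := by
    simp only [bicubicAffine]
    rw [Finset.sum_comm]
    simp only [h.symm, mul_comm (affineCoeff l r _ i)]
  gram := by
    rw [gram_eq_iff]
    intro z w
    rw [septic_septicAffine, septic_septicAffine, gram_eq_iff.1 h.gram, bicubic_bicubicAffine]
    ring
  indep z := by
    rw [septic_septicAffine, septicDeriv_septicAffine]
    have := linearIndependent_pair_of_det (h.indep (l * z + r)) (a := 1) (b := 0) (c := 0) (d := l)
      (by simpa)
    simpa using this
  indep_top := by
    -- The two top coefficients of `septic v (l * z + r)` are `l ^ 7 • v 7` and `(7 * l ^ 6 * r) • v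
    -- 7 + l ^ 6 • v 6`.
    have := linearIndependent_pair_of_det h.indep_top (a := l ^ 7) (b := 0) (c := 7 * l ^ 6 * r)
      (d := l ^ 6) (by simp [hl])
    convert this using 2 <;>
      simp [septicAffine, Finset.sum_range_succ, affineCoeff, Nat.choose]
    abel

/-- The coefficients of `z ^ 7 * septic v z⁻¹`. -/
def septicRev (v : ℕ → V) (k : ℕ) : V := v (7 - k)

theorem septic_septicRev (v : ℕ → V) {z : ℂ} (hz : z ≠ 0) :
    septic (septicRev v) z = z ^ 7 • septic v z⁻¹ := by
  simp only [septic, septicRev, Finset.sum_range_succ, Finset.range_zero, Finset.sum_empty]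
  match_scalars <;> simp [field]

theorem septicDeriv_septicRev (v : ℕ → V) {z : ℂ} (hz : z ≠ 0) :
    septicDeriv (septicRev v) z =
      (7 * z ^ 6) • septic v z⁻¹ + (-z ^ 5) • septicDeriv v z⁻¹ := by
  simp only [septic, septicDeriv, septicRev, Finset.sum_range_succ, Finset.range_zero,
    Finset.sum_empty]
  match_scalars <;> norm_num <;> field_simp <;> ring

/-- Reversal replaces `t` by `4 - t` in the binomial sum; the sign survives because the exponent 4
is even. -/
theorem gramCoeff_rev (m : ℕ → ℕ → ℂ) : ∀ i < 8, ∀ j < 8,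
    gramCoeff m (7 - i) (7 - j) = gramCoeff (fun i j => m (3 - i) (3 - j)) i j := by
  intro i hi j hj
  simp only [gramCoeff]
  rw [← Finset.sum_range_reflect]
  refine Finset.sum_congr rfl fun t ht => ?_
  have ht : t < 5 := Finset.mem_range.1 ht
  by_cases h : t ≤ i ∧ 4 - t ≤ j ∧ i - t < 4 ∧ j - (4 - t) < 4
  · rw [if_pos h, if_pos (by omega), show 5 - 1 - t = 4 - t by omega,
      show 7 - i - (4 - t) = 3 - (i - t) by omega,
      show 7 - j - (4 - (4 - t)) = 3 - (j - (4 - t)) by omega, Nat.choose_symm (by omega)]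
    congr 2
    interval_cases t <;> norm_num
  · rw [if_neg h, if_neg (by omega)]

theorem IsNullSeptic.rev {B : LinearMap.BilinForm ℂ V} {v : ℕ → V} {m : ℕ → ℕ → ℂ}
    (h : IsNullSeptic B v m) :
    IsNullSeptic B (septicRev v) (fun i j => m (3 - i) (3 - j)) where
  symm i j := h.symm _ _
  gram i hi j hj := by
    rw [← gramCoeff_rev m i hi j hj, septicRev, septicRev,
      h.gram _ (by omega) _ (by omega)]
  indep z := by
    by_cases hz : z = 0
    · have := h.indep_top
      subst hz
      simpa [septic, septicDeriv, septicRev, Finset.sum_range_succ] using this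
    · have := linearIndependent_pair_of_det (h.indep z⁻¹) (a := z ^ 7) (b := 0) (c := 7 * z ^ 6)
        (d := -z ^ 5) (by simp [hz])
      rw [septic_septicRev v hz, septicDeriv_septicRev v hz]
      simpa using this
  indep_top := by
    have := h.indep 0
    simpa [septic, septicDeriv, septicRev, Finset.sum_range_succ] using this

end Septic

/-! ### Local analysis at a zero of the diagonal sextic. -/

section NullSeptic

variable {V : Type*} [AddCommGroup V] [Module ℂ V]
  {B : LinearMap.BilinForm ℂ V} {v : ℕ → V} {m : ℕ → ℕ → ℂ}

theorem IsNullSeptic.indep_zero (h : IsNullSeptic B v m) : LinearIndependent ℂ ![v 0, v 1] := by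
  simpa [septic, septicDeriv, Finset.sum_range_succ] using h.indep 0

theorem septic_apply (u : V) (z : ℂ) :
    B u (septic v z) = ∑ k ∈ Finset.range 8, z ^ k * B u (v k) := by
  simp [septic]

/-- If the second derivative is not isotropic at `0`, then the curve is not contained in a
hyperplane. -/
theorem IsNullSeptic.eq_zero_of_ne_zero (hV : Module.finrank ℂ V = 5)
    (hB : B.Nondegenerate) (h : IsNullSeptic B v m) (h00 : m 0 0 ≠ 0) {u : V}
    (hu : ∀ z, B u (septic v z) = 0) : u = 0 := by
  have hu' := coeff_eq_zero_of_forall_sum (fun z => (septic_apply u z).symm.trans (hu z))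
  have g := h.gram
  have hli : LinearIndependent ℂ (fun i : Fin 5 => v i) := by
    rw [Fintype.linearIndependent_iff]
    intro c hc
    -- The Gram matrix of `v 0, …, v 4` vanishes for `i + j < 4` and has nonzero multiples of `m 0
    -- 0` on the antidiagonal, so it is invertible.
    have key (j : ℕ) (hj : j < 8) : ∑ i : Fin 5, c i * gramCoeff m j i = 0 := by
      have := congrArg (B (v j)) hc
      simp only [map_sum, map_smul, smul_eq_mul, map_zero] at this
      rw [← this]
      exact Finset.sum_congr rfl fun i _ => by rw [g j hj i (by omega)]
    have k0 := key 0 (by norm_num)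
    have k1 := key 1 (by norm_num)
    have k2 := key 2 (by norm_num)
    have k3 := key 3 (by norm_num)
    have k4 := key 4 (by norm_num)
    simp [Fin.sum_univ_five, gramCoeff, Finset.sum_range_succ, Nat.choose, h00] at k0 k1 k2 k3 k4
    have c4 : c 4 = 0 := k0
    simp [c4, h00] at k1 k2 k3 k4
    have c3 : c 3 = 0 := k1
    simp [c3, h00] at k2 k3 k4
    have c2 : c 2 = 0 := k2
    simp [c2, h00] at k3 k4
    have c1 : c 1 = 0 := k3
    simp [c1, h00] at k4
    intro i
    fin_cases i <;> assumption
  have hspan : Submodule.span ℂ (Set.range fun i : Fin 5 => v i) = ⊤ :=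
    hli.span_eq_top_of_card_eq_finrank (by simp [hV])
  have hBu : B u = 0 := by
    apply LinearMap.ext_on hspan
    rintro _ ⟨i, rfl⟩
    simpa using hu' i (by omega)
  exact hB.1 u fun w => by rw [hBu]; simp

variable [FiniteDimensional ℂ V]

theorem IsNullSeptic.exists_eq_of_isotropic (hV : Module.finrank ℂ V = 5) (hs : B.IsSymm)
    (hB : B.Nondegenerate) (h : IsNullSeptic B v m) {w : V} (h0 : B (v 0) w = 0)
    (h1 : B (v 1) w = 0) (hw : B w w = 0) : ∃ s t : ℂ, w = s • v 0 + t • v 1 := by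
  refine _root_.exists_eq_of_isotropic hV hs hB h.indep_zero ?_ ?_ ?_ h0 h1 hw <;>
  · rw [h.gram _ (by norm_num) _ (by norm_num)]
    simp [gramCoeff, Finset.sum_range_succ]

/-- If the second derivative is isotropic at `0` then it is tangent to the curve. -/
theorem IsNullSeptic.tangent_of_root (hV : Module.finrank ℂ V = 5) (hs : B.IsSymm)
    (hB : B.Nondegenerate) (h : IsNullSeptic B v m) (h00 : m 0 0 = 0) :
    m 0 1 = 0 ∧ 4 * m 1 1 = 7 * m 0 2 := by
  have g := h.gram
  obtain ⟨s, t, hst⟩ := h.exists_eq_of_isotropic hV hs hB (w := v 2)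
    (by rw [g _ (by norm_num) _ (by norm_num)]; simp [gramCoeff, Finset.sum_range_succ])
    (by rw [g _ (by norm_num) _ (by norm_num)]; simp [gramCoeff, Finset.sum_range_succ])
    (by rw [g _ (by norm_num) _ (by norm_num)]; simp [gramCoeff, Finset.sum_range_succ, h00])
  have key (j : ℕ) (hj : j < 8) :
      gramCoeff m 2 j = s * gramCoeff m 0 j + t * gramCoeff m 1 j := by
    rw [← g 0 (by norm_num) j hj, ← g 1 (by norm_num) j hj, ← g 2 (by norm_num) j hj, hst]
    simp
  -- Since `v 2` lies in the span of `v 0` and `v 1`, pairing with `v 3` gives `m 0 1 = 0`, and then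
  -- pairing with `v 4` gives the second relation.
  have k3 := key 3 (by norm_num)
  have k4 := key 4 (by norm_num)
  simp [gramCoeff, Finset.sum_range_succ, Nat.choose, h00] at k3 k4
  have h01 : m 0 1 = 0 := by linear_combination k3 / 2 + 2 * h.symm 1 0
  refine ⟨h01, ?_⟩
  linear_combination -k4 - t * h.symm 1 0 + h.symm 2 0 + (3 * t) * h01

/-- If the third derivative is isotropic at `0` as well, then the curve is contained in the tangent
hyperplane of the quadric at its point at `0`. -/
theorem IsNullSeptic.tangent_of_double_root (hV : Module.finrank ℂ V = 5) (hs : B.IsSymm)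
    (hB : B.Nondegenerate) (h : IsNullSeptic B v m) (h00 : m 0 0 = 0) (h02 : m 0 2 = 0) :
    m 0 3 = 0 ∧ m 1 2 = 0 := by
  have g := h.gram
  obtain ⟨h01, h11⟩ := h.tangent_of_root hV hs hB h00
  replace h11 : m 1 1 = 0 := by linear_combination h11 / 4 + 7 / 4 * h02
  have h10 : m 1 0 = 0 := (h.symm 1 0).trans h01
  have h20 : m 2 0 = 0 := (h.symm 2 0).trans h02
  obtain ⟨s, t, hst⟩ := h.exists_eq_of_isotropic hV hs hB (w := v 2)
    (by rw [g _ (by norm_num) _ (by norm_num)]; simp [gramCoeff, Finset.sum_range_succ])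
    (by rw [g _ (by norm_num) _ (by norm_num)]; simp [gramCoeff, Finset.sum_range_succ])
    (by rw [g _ (by norm_num) _ (by norm_num)]; simp [gramCoeff, Finset.sum_range_succ, h00])
  obtain ⟨s', t', hst'⟩ := h.exists_eq_of_isotropic hV hs hB (w := v 3)
    (by rw [g _ (by norm_num) _ (by norm_num)]; simp [gramCoeff, Finset.sum_range_succ])
    (by rw [g _ (by norm_num) _ (by norm_num)]; simp [gramCoeff, Finset.sum_range_succ, h00])
    (by rw [g _ (by norm_num) _ (by norm_num)]
        simp [gramCoeff, Finset.sum_range_succ, h02, h11, h20])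
  -- Both `v 2` and `v 3` now lie in the tangent plane. The pairings of `v 2` with `v 5` and of `v
  -- 3` with `v 4` give two independent equations in `m 0 3` and `m 1 2`.
  have k5 : gramCoeff m 2 5 = s * gramCoeff m 0 5 + t * gramCoeff m 1 5 := by
    rw [← g 0 (by norm_num) 5 (by norm_num), ← g 1 (by norm_num) 5 (by norm_num),
      ← g 2 (by norm_num) 5 (by norm_num), hst]
    simp
  have k4 : gramCoeff m 3 4 = s' * gramCoeff m 0 4 + t' * gramCoeff m 1 4 := by
    rw [← g 0 (by norm_num) 4 (by norm_num), ← g 1 (by norm_num) 4 (by norm_num),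
      ← g 3 (by norm_num) 4 (by norm_num), hst']
    simp
  simp [gramCoeff, Finset.sum_range_succ, Nat.choose, h00, h01, h10, h02, h11] at k4 k5
  rw [h.symm 3 0, h.symm 2 1] at k4
  rw [h.symm 2 1] at k5
  constructor
  · linear_combination (2 * k5 + 3 * k4) / 3
  · linear_combination 2 * k4 + k5

/-- The vanishing coefficient `2 * m 0 2 + m 1 1` and the relation `4 * m 1 1 = 7 * m 0 2` at a zero
kill both entries; the same happens at infinity. Then `m = 0`, so all `v k` are isotropic and
orthogonal to `v 0, v 1`. -/
theorem IsNullSeptic.isotropic_of_bicubic_diag (hV : Module.finrank ℂ V = 5) (hs : B.IsSymm)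
    (hB : B.Nondegenerate) (h : IsNullSeptic B v m) (hd : ∀ z, bicubic m z z = 0) :
    ∀ k < 8, v k ∈ Submodule.span ℂ {v 0, v 1} := by
  have hc := coeff_eq_zero_of_forall_sum (n := 7) (c := fun n => match n with
    | 0 => m 0 0
    | 1 => 2 * m 0 1
    | 2 => 2 * m 0 2 + m 1 1
    | 3 => 2 * m 0 3 + 2 * m 1 2
    | 4 => 2 * m 1 3 + m 2 2
    | 5 => 2 * m 2 3
    | _ => m 3 3) (fun z => by
      rw [← hd z]
      simp [bicubic, Finset.sum_range_succ, h.symm 1 0, h.symm 2 0, h.symm 3 0, h.symm 2 1,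
        h.symm 3 1, h.symm 3 2]
      ring)
  have h00 : m 0 0 = 0 := hc 0 (by norm_num)
  have c2 : 2 * m 0 2 + m 1 1 = 0 := hc 2 (by norm_num)
  have c4 : 2 * m 1 3 + m 2 2 = 0 := hc 4 (by norm_num)
  have h33 : m 3 3 = 0 := hc 6 (by norm_num)
  obtain ⟨h01, h11⟩ := h.tangent_of_root hV hs hB h00
  obtain ⟨h32, h22⟩ := h.rev.tangent_of_root hV hs hB h33
  norm_num at h32 h22
  rw [h.symm 3 1] at h22
  have h02 : m 0 2 = 0 := by linear_combination (4 * c2 - h11) / 15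
  have h13 : m 1 3 = 0 := by linear_combination (4 * c4 - h22) / 15
  rw [h02] at h11 c2
  rw [h13] at h22 c4
  obtain ⟨h03, h12⟩ := h.tangent_of_double_root hV hs hB h00 h02
  have hm : ∀ i < 4, ∀ j < 4, m i j = 0 := by
    intro i hi j hj
    interval_cases i <;> interval_cases j <;> first | assumption | (rw [h.symm]; assumption) | skip
    · simpa using h11
    · simpa using h22
  have hg : ∀ i < 8, ∀ j < 8, B (v i) (v j) = 0 := by
    intro i hi j hj
    rw [h.gram i hi j hj, gramCoeff]
    refine Finset.sum_eq_zero fun t _ => ?_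
    split_ifs with hc
    · rw [hm _ hc.2.2.1 _ hc.2.2.2, mul_zero]
    · rfl
  intro k hk
  obtain ⟨s, t, hst⟩ := h.exists_eq_of_isotropic hV hs hB (hg 0 (by norm_num) k hk)
    (hg 1 (by norm_num) k hk) (hg k hk k hk)
  exact Submodule.mem_span_pair.2 ⟨s, t, hst.symm⟩

end NullSeptic

/-! ### Global analysis: three double zeros, normalized to infinity, 0 and 1. -/

section NoNullSeptic

variable {V : Type*} [AddCommGroup V] [Module ℂ V]
  {B : LinearMap.BilinForm ℂ V} {v : ℕ → V} {m : ℕ → ℕ → ℂ}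

/-- A null curve of degree `7` that is not contained in a hyperplane. -/
structure IsFullNullSeptic (B : LinearMap.BilinForm ℂ V) (v : ℕ → V) (m : ℕ → ℕ → ℂ) : Prop
    extends IsNullSeptic B v m where
  full : ∀ u, (∀ z, B u (septic v z) = 0) → u = 0

theorem IsFullNullSeptic.affine (h : IsFullNullSeptic B v m) {l : ℂ} (hl : l ≠ 0) (r : ℂ) :
    IsFullNullSeptic B (septicAffine l r v) (bicubicAffine l r m) where
  toIsNullSeptic := h.toIsNullSeptic.affine hl r
  full u hu := h.full u fun z => by
    have := hu ((z - r) / l)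
    rwa [septic_septicAffine, mul_div_cancel₀ _ hl, sub_add_cancel] at this

theorem IsFullNullSeptic.rev (h : IsFullNullSeptic B v m) :
    IsFullNullSeptic B (septicRev v) (fun i j => m (3 - i) (3 - j)) where
  toIsNullSeptic := h.toIsNullSeptic.rev
  full u hu := h.full u fun z => by
    have := coeff_eq_zero_of_forall_sum (fun z => (septic_apply u z).symm.trans (hu z))
    rw [septic_apply]
    refine Finset.sum_eq_zero fun k hk => ?_
    have hk : k < 8 := Finset.mem_range.1 hk
    have := this (7 - k) (by omega)
    rw [septicRev, show 7 - (7 - k) = k by omega] at this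
    rw [this, mul_zero]

theorem bicubicAffine_zero_zero (l r : ℂ) (m : ℕ → ℕ → ℂ) :
    bicubicAffine l r m 0 0 = l ^ 4 * bicubic m r r := by
  have := bicubic_bicubicAffine l r m 0 0
  simpa [bicubic, Finset.sum_range_succ] using this

theorem bicubicAffine_three_three (l r : ℂ) (m : ℕ → ℕ → ℂ) :
    bicubicAffine l r m 3 3 = l ^ 10 * m 3 3 := by
  simp [bicubicAffine, affineCoeff, Finset.sum_range_succ, Nat.choose]
  ring

/-- The condition `m' 3 3 = 0` means a zero of the sextic at infinity. A sextic without finite zeros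
is constant, so it already has one there. -/
theorem IsFullNullSeptic.exists_root_top (h : IsFullNullSeptic B v m) :
    ∃ v' m', IsFullNullSeptic B v' m' ∧ m' 3 3 = 0 := by
  by_cases hroot : ∃ r, bicubic m r r = 0
  · obtain ⟨r, hr⟩ := hroot
    exact ⟨_, _, (h.affine one_ne_zero r).rev, by simp [bicubicAffine_zero_zero, hr]⟩
  · refine ⟨v, m, h, ?_⟩
    push Not at hroot
    exact coeff_eq_zero_of_forall_sum_ne_zero (n := 7) (c := fun n => match n with
    | 0 => m 0 0
    | 1 => m 0 1 + m 1 0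
    | 2 => m 0 2 + m 1 1 + m 2 0
    | 3 => m 0 3 + m 1 2 + m 2 1 + m 3 0
    | 4 => m 1 3 + m 2 2 + m 3 1
    | 5 => m 2 3 + m 3 2
    | _ => m 3 3) (fun z => by
      convert hroot z using 1
      simp [bicubic, Finset.sum_range_succ]
      ring) 6 (by norm_num) (by norm_num)

variable [FiniteDimensional ℂ V]

/-- The zeros of the sextic `bicubic m z z` are exactly double. -/
theorem IsFullNullSeptic.ne_zero_of_root (hV : Module.finrank ℂ V = 5) (hs : B.IsSymm)
    (hB : B.Nondegenerate) (h : IsFullNullSeptic B v m) (h00 : m 0 0 = 0) : m 0 2 ≠ 0 := by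
  intro h02
  obtain ⟨h01, h11⟩ := h.tangent_of_root hV hs hB h00
  obtain ⟨h03, h12⟩ := h.tangent_of_double_root hV hs hB h00 h02
  refine h.indep_zero.ne_zero 0 (h.full (v 0) fun z => ?_)
  rw [septic_apply]
  refine Finset.sum_eq_zero fun k hk => ?_
  have hk : k < 8 := Finset.mem_range.1 hk
  rw [h.gram 0 (by norm_num) k hk]
  interval_cases k <;> simp [gramCoeff, Finset.sum_range_succ, h00, h01, h02, h03]

/-- The zero at infinity is exactly double, so the sextic has degree 4 in `z` and must have a finite
zero. -/
theorem IsFullNullSeptic.exists_root_zero (hV : Module.finrank ℂ V = 5) (hs : B.IsSymm)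
    (hB : B.Nondegenerate) (h : IsFullNullSeptic B v m) (h33 : m 3 3 = 0) :
    ∃ v' m', IsFullNullSeptic B v' m' ∧ m' 3 3 = 0 ∧ m' 0 0 = 0 := by
  by_cases hroot : ∃ r, bicubic m r r = 0
  · obtain ⟨r, hr⟩ := hroot
    exact ⟨_, _, h.affine one_ne_zero r, by simp [bicubicAffine_three_three, h33],
      by simp [bicubicAffine_zero_zero, hr]⟩
  · exfalso
    push Not at hroot
    obtain ⟨h32, h22⟩ := h.rev.tangent_of_root hV hs hB h33
    have h31 := h.rev.ne_zero_of_root hV hs hB h33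
    norm_num at h32 h22 h31
    have h4 : m 1 3 + m 2 2 + m 3 1 = 0 :=
      coeff_eq_zero_of_forall_sum_ne_zero (n := 5) (c := fun n => match n with
      | 0 => m 0 0
      | 1 => m 0 1 + m 1 0
      | 2 => m 0 2 + m 1 1 + m 2 0
      | 3 => m 0 3 + m 1 2 + m 2 1 + m 3 0
      | _ => m 1 3 + m 2 2 + m 3 1) (fun z => by
        convert hroot z using 1
        simp [bicubic, Finset.sum_range_succ, h.symm 2 3, h32, h33]
        ring) 4 (by norm_num) (by norm_num)
    apply h31
    linear_combination (4 * h4 - h22 - 4 * h.symm 1 3) / 15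

theorem IsFullNullSeptic.exists_root_one (hV : Module.finrank ℂ V = 5) (hs : B.IsSymm)
    (hB : B.Nondegenerate) (h : IsFullNullSeptic B v m) (h33 : m 3 3 = 0) (h00 : m 0 0 = 0) :
    ∃ v' m', IsFullNullSeptic B v' m' ∧ m' 3 3 = 0 ∧ m' 0 0 = 0 ∧ bicubic m' 1 1 = 0 := by
  obtain ⟨h32, h22⟩ := h.rev.tangent_of_root hV hs hB h33
  have h31 := h.rev.ne_zero_of_root hV hs hB h33
  norm_num at h32 h22 h31
  obtain ⟨h01, h11⟩ := h.tangent_of_root hV hs hB h00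
  have h02 := h.ne_zero_of_root hV hs hB h00
  -- The quadratic factor has end coefficients `15 / 4 * m 0 2` and `15 / 4 * m 1 3`, both nonzero;
  -- hence it has a nonzero root, which scaling moves to 1.
  have hb (z : ℂ) : bicubic m z z = z ^ 2 * ((m 0 2 + m 1 1 + m 2 0) +
      (m 0 3 + m 1 2 + m 2 1 + m 3 0) * z + (m 1 3 + m 2 2 + m 3 1) * z ^ 2) := by
    simp [bicubic, Finset.sum_range_succ, h00, h01, h32, h33, h.symm 2 3, h.symm 1 0]
    ring
  have hroot : ∃ r, r ≠ 0 ∧ bicubic m r r = 0 := by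
    by_contra! hroot
    have h4 : m 1 3 + m 2 2 + m 3 1 = 0 :=
      coeff_eq_zero_of_forall_sum_ne_zero (n := 3) (c := fun n => match n with
      | 0 => m 0 2 + m 1 1 + m 2 0
      | 1 => m 0 3 + m 1 2 + m 2 1 + m 3 0
      | _ => m 1 3 + m 2 2 + m 3 1) (fun z => by
        by_cases hz : z = 0
        · simp [hz, Finset.sum_range_succ]
          intro h2
          apply h02
          linear_combination (4 * h2 - h11 - 4 * h.symm 2 0) / 15
        · have := hroot z hz
          rw [hb] at this
          convert right_ne_zero_of_mul this using 1
          simp [Finset.sum_range_succ]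
          ring) 2 (by norm_num) (by norm_num)
    apply h31
    linear_combination (4 * h4 - h22 - 4 * h.symm 1 3) / 15
  obtain ⟨r, hr0, hr⟩ := hroot
  refine ⟨_, _, h.affine hr0 0, by simp [bicubicAffine_three_three, h33], ?_, ?_⟩
  · rw [bicubicAffine_zero_zero]
    simp [bicubic, Finset.sum_range_succ, h00]
  · rw [bicubic_bicubicAffine]
    simp [hr]

theorem IsFullNullSeptic.false_of_roots (hV : Module.finrank ℂ V = 5) (hs : B.IsSymm)
    (hB : B.Nondegenerate) (h : IsFullNullSeptic B v m) (h33 : m 3 3 = 0) (h00 : m 0 0 = 0)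
    (h1 : bicubic m 1 1 = 0) : False := by
  obtain ⟨h32, h22⟩ := h.rev.tangent_of_root hV hs hB h33
  norm_num at h32 h22
  obtain ⟨h01, h11⟩ := h.tangent_of_root hV hs hB h00
  have h02 := h.ne_zero_of_root hV hs hB h00
  obtain ⟨e1, e2⟩ := (h.affine one_ne_zero 1).tangent_of_root hV hs hB
    (by rw [bicubicAffine_zero_zero, h1, mul_zero])
  simp [bicubicAffine, bicubic, affineCoeff, Finset.sum_range_succ, Nat.choose, h00, h01, h32, h33,
    h.symm 1 0, h.symm 2 0, h.symm 3 0, h.symm 2 1, h.symm 3 1, h.symm 2 3] at e1 e2 h1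
  rw [h.symm 3 1] at h22
  have h11' : m 1 1 = 7 / 4 * m 0 2 := by linear_combination h11 / 4
  have h22' : m 2 2 = 7 / 4 * m 1 3 := by linear_combination h22 / 4
  rw [h11', h22'] at e1 e2 h1
  have e13 : m 1 3 = m 0 2 := by linear_combination 4 / 15 * (2 * e1 - 3 * h1)
  rw [e13] at e1 e2 h1
  have e12 : m 1 2 = - m 0 3 - 15 / 4 * m 0 2 := by linear_combination h1 / 2
  rw [e12] at e2
  have e03 : m 0 3 = - m 0 2 / 2 := by linear_combination -e2 / 30
  -- With `a = m 0 2`, the Gram matrix of `v 3, v 4` has diagonal entries `5 / 2 * a` and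
  -- off-diagonal entry `-5 * a`, so its determinant is `-75 / 4 * a ^ 2`.
  have hdet := gram_det_eq_zero_of_orthogonal hV hs hB h.indep_zero (u := v 3) (w := v 4)
    (by rw [h.gram _ (by norm_num) _ (by norm_num)]; simp [gramCoeff, Finset.sum_range_succ])
    (by rw [h.gram _ (by norm_num) _ (by norm_num)]; simp [gramCoeff, Finset.sum_range_succ])
    (by rw [h.gram _ (by norm_num) _ (by norm_num)]; simp [gramCoeff, Finset.sum_range_succ])
    (by rw [h.gram _ (by norm_num) _ (by norm_num)]; simp [gramCoeff, Finset.sum_range_succ])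
    (by rw [h.gram _ (by norm_num) _ (by norm_num)]; simp [gramCoeff, Finset.sum_range_succ, h00])
    (by rw [h.gram _ (by norm_num) _ (by norm_num)]; simp [gramCoeff, Finset.sum_range_succ, h00])
    (by rw [h.gram _ (by norm_num) _ (by norm_num)]
        simp [gramCoeff, Finset.sum_range_succ, h01, h.symm 1 0])
  rw [h.gram 3 (by norm_num) 3 (by norm_num), h.gram 3 (by norm_num) 4 (by norm_num),
    h.gram 4 (by norm_num) 4 (by norm_num)] at hdet
  simp [gramCoeff, Finset.sum_range_succ, Nat.choose, h.symm 2 0, h.symm 3 0,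
    h.symm 2 1, h.symm 3 1, h11', h22', e13, e12, e03] at hdet
  apply h02
  have : m 0 2 ^ 2 = 0 := by linear_combination -4 / 75 * hdet
  simpa using this

/-- Every null curve of degree `7` is contained in a line. -/
theorem IsNullSeptic.mem_span (hV : Module.finrank ℂ V = 5) (hs : B.IsSymm)
    (hB : B.Nondegenerate) (h : IsNullSeptic B v m) :
    ∀ k < 8, v k ∈ Submodule.span ℂ {v 0, v 1} := by
  by_cases hd : ∀ z, bicubic m z z = 0
  · exact h.isotropic_of_bicubic_diag hV hs hB hd
  · exfalso
    push Not at hd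
    obtain ⟨r, hr⟩ := hd
    -- Moving a nonzero of the sextic to 0 yields fullness.
    have hfull : IsFullNullSeptic B (septicAffine 1 r v) (bicubicAffine 1 r m) :=
      ⟨h.affine one_ne_zero r, fun u hu => (h.affine one_ne_zero r).eq_zero_of_ne_zero hV hB
        (by simpa [bicubicAffine_zero_zero] using hr) hu⟩
    obtain ⟨v₁, m₁, h₁, h33⟩ := hfull.exists_root_top
    obtain ⟨v₂, m₂, h₂, h33, h00⟩ := h₁.exists_root_zero hV hs hB h33
    obtain ⟨v₃, m₃, h₃, h33, h00, h11⟩ := h₂.exists_root_one hV hs hB h33 h00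
    exact h₃.false_of_roots hV hs hB h33 h00 h11

end NoNullSeptic

/-! ### Divisibility of the Gram kernel by `(z - w) ^ 4`. -/

section GramMatrix

/-- The coefficients of the quotient by `(z - w) ^ 4` of the polynomial with symmetric coefficient
matrix `k`. -/
def quotientCoeffAux (k : ℕ → ℕ → ℂ) : ℕ → ℕ → ℂ
  | 0, j => k 0 (j + 4)
  | 1, 1 => k 1 5 + 4 * k 0 6
  | 1, 2 => k 1 6 + 4 * k 0 7
  | 1, 3 => k 1 7
  | 2, 2 => k 2 6 + 4 * k 1 7
  | 2, 3 => k 2 7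
  | 3, 3 => k 3 7
  | _, _ => 0

/-- The symmetric coefficient matrix with upper triangular part `quotientCoeffAux k`. -/
def quotientCoeff (k : ℕ → ℕ → ℂ) (i j : ℕ) : ℂ :=
  quotientCoeffAux k (min i j) (max i j)

-- A symmetric kernel is even in `z - w`, so its order along the diagonal is even. `h0` removes
-- order 0 and `h1` order 2, which leaves order at least 4.
set_option maxHeartbeats 2000000 in
theorem eq_gramCoeff_quotientCoeff {k : ℕ → ℕ → ℂ} (hk : ∀ i j, k i j = k j i)
    (h0 : ∀ z : ℂ, ∑ i ∈ Finset.range 8, ∑ j ∈ Finset.range 8, z ^ i * z ^ j * k i j = 0)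
    (h1 : ∀ z : ℂ, ∑ i ∈ Finset.range 7, ∑ j ∈ Finset.range 7,
      (((i : ℂ) + 1) * z ^ i) * (((j : ℂ) + 1) * z ^ j) * k (i + 1) (j + 1) = 0) :
    ∀ i < 8, ∀ j < 8, k i j = gramCoeff (quotientCoeff k) i j := by
  have H0 := coeff_eq_zero_of_forall_sum (n := 15) (c := fun n => match n with
    | 0 => k 0 0
    | 1 => 2 * k 0 1
    | 2 => 2 * k 0 2 + k 1 1
    | 3 => 2 * k 0 3 + 2 * k 1 2
    | 4 => 2 * k 0 4 + 2 * k 1 3 + k 2 2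
    | 5 => 2 * k 0 5 + 2 * k 1 4 + 2 * k 2 3
    | 6 => 2 * k 0 6 + 2 * k 1 5 + 2 * k 2 4 + k 3 3
    | 7 => 2 * k 0 7 + 2 * k 1 6 + 2 * k 2 5 + 2 * k 3 4
    | 8 => 2 * k 1 7 + 2 * k 2 6 + 2 * k 3 5 + k 4 4
    | 9 => 2 * k 2 7 + 2 * k 3 6 + 2 * k 4 5
    | 10 => 2 * k 3 7 + 2 * k 4 6 + k 5 5
    | 11 => 2 * k 4 7 + 2 * k 5 6
    | 12 => 2 * k 5 7 + k 6 6
    | 13 => 2 * k 6 7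
    | _ => k 7 7) (fun z => by
      rw [← h0 z]
      simp only [Finset.sum_range_succ, Finset.range_zero, Finset.sum_empty, hk 1 0, hk 2 0, hk 3 0,
        hk 4 0, hk 5 0, hk 6 0, hk 7 0, hk 2 1, hk 3 1, hk 4 1, hk 5 1, hk 6 1, hk 7 1, hk 3 2,
        hk 4 2, hk 5 2, hk 6 2, hk 7 2, hk 4 3, hk 5 3, hk 6 3, hk 7 3, hk 5 4, hk 6 4, hk 7 4,
        hk 6 5, hk 7 5, hk 7 6]
      ring)
  have H1 := coeff_eq_zero_of_forall_sum (n := 13) (c := fun n => match n with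
    | 0 => k 1 1
    | 1 => 2 * 2 * k 1 2
    | 2 => 2 * 3 * k 1 3 + 4 * k 2 2
    | 3 => 2 * 4 * k 1 4 + 2 * 6 * k 2 3
    | 4 => 2 * 5 * k 1 5 + 2 * 8 * k 2 4 + 9 * k 3 3
    | 5 => 2 * 6 * k 1 6 + 2 * 10 * k 2 5 + 2 * 12 * k 3 4
    | 6 => 2 * 7 * k 1 7 + 2 * 12 * k 2 6 + 2 * 15 * k 3 5 + 16 * k 4 4
    | 7 => 2 * 14 * k 2 7 + 2 * 18 * k 3 6 + 2 * 20 * k 4 5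
    | 8 => 2 * 21 * k 3 7 + 2 * 24 * k 4 6 + 25 * k 5 5
    | 9 => 2 * 28 * k 4 7 + 2 * 30 * k 5 6
    | 10 => 2 * 35 * k 5 7 + 36 * k 6 6
    | 11 => 2 * 42 * k 6 7
    | _ => 49 * k 7 7) (fun z => by
      rw [← h1 z]
      simp only [Finset.sum_range_succ, Finset.range_zero, Finset.sum_empty, zero_add,
        Nat.reduceAdd, hk 2 1, hk 3 1, hk 4 1, hk 5 1, hk 6 1, hk 7 1, hk 3 2,
        hk 4 2, hk 5 2, hk 6 2, hk 7 2, hk 4 3, hk 5 3, hk 6 3, hk 7 3, hk 5 4, hk 6 4, hk 7 4,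
        hk 6 5, hk 7 5, hk 7 6]
      push_cast
      ring)
  have E (n : ℕ) (hn : n < 15) := H0 n hn
  have F (n : ℕ) (hn : n < 13) := H1 n hn
  clear H0 H1 h0 h1
  intro i hi j hj
  wlog hij : i ≤ j generalizing i j
  · rw [hk, this j hj i hi (by omega), gramCoeff, gramCoeff, ← Finset.sum_range_reflect]
    refine Finset.sum_congr rfl fun t ht => ?_
    have ht : t < 5 := Finset.mem_range.1 ht
    by_cases h : t ≤ i ∧ 4 - t ≤ j ∧ i - t < 4 ∧ j - (4 - t) < 4
    · rw [if_pos h, if_pos (by omega), show 5 - 1 - t = 4 - t by omega,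
        show 4 - (4 - t) = t by omega, Nat.choose_symm (by omega), quotientCoeff, quotientCoeff,
        min_comm, max_comm]
      congr 2
      interval_cases t <;> norm_num
    · rw [if_neg h, if_neg (by omega)]
  · by_cases h2 : i + j < 2
    · have e := E (i + j) (by omega)
      interval_cases i <;> interval_cases j <;> first | omega | skip
      all_goals
        simp [gramCoeff, quotientCoeff, quotientCoeffAux, Finset.sum_range_succ] at e ⊢
        grind
    -- Each antidiagonal satisfies two linear relations; differentiating in both variables shifts
    -- the index of the second by 2.
    · have e := E (i + j) (by omega)
      have f := F (i + j - 2) (by omega)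
      clear E F
      interval_cases i <;> interval_cases j <;> first | omega | skip
      all_goals
        simp [gramCoeff, quotientCoeff, quotientCoeffAux, Finset.sum_range_succ, Nat.choose]
          at e f ⊢
        try grind

end GramMatrix

/-! ### Removable singularities and entire functions of polynomial growth. -/

section Analysis

/-- A zero of `f` is simple, so `(z - z₀) / f z` extends to a unit. At the zero itself the
convention `0⁻¹ = 0` breaks the identity, whence the punctured neighbourhood. -/
theorem exists_analyticAt_inv {f : ℂ → ℂ} {z₀ : ℂ} (hf : AnalyticAt ℂ f z₀)
    (h : f z₀ = 0 → deriv f z₀ ≠ 0) :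
    ∃ c : ℂ → ℂ, AnalyticAt ℂ c z₀ ∧ c z₀ ≠ 0 ∧ (f z₀ ≠ 0 → (f z₀)⁻¹ = c z₀) ∧
      ∀ᶠ z in 𝓝[≠] z₀, (if f z₀ = 0 then z - z₀ else 1) * (f z)⁻¹ = c z := by
  by_cases h0 : f z₀ = 0
  · obtain ⟨p, hp⟩ := hf
    have han : AnalyticAt ℂ (dslope f z₀) z₀ := ⟨_, hp.has_fpower_series_dslope_fslope⟩
    have hne : dslope f z₀ z₀ ≠ 0 := by rw [dslope_same]; exact h h0
    refine ⟨fun z => (dslope f z₀ z)⁻¹, han.inv hne, inv_ne_zero hne,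
      fun h => absurd h0 h, ?_⟩
    filter_upwards [self_mem_nhdsWithin] with z hz
    have hz : z - z₀ ≠ 0 := sub_ne_zero.2 hz
    have := sub_smul_dslope f z₀ z
    rw [h0, sub_zero, smul_eq_mul] at this
    rw [if_pos h0, ← this, mul_inv, mul_inv_cancel_left₀ hz]
  · exact ⟨fun z => (f z)⁻¹, hf.inv h0, inv_ne_zero h0, fun _ => rfl, by simp [h0]⟩

variable {V : Type*} [NormedAddCommGroup V] [NormedSpace ℂ V] [CompleteSpace V]

/-- A function on the plane that has only removable singularities extends to an entire function. -/
theorem exists_entire_of_forall_exists_analyticAt {f : ℂ → V} {A : ℂ → ℂ → V}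
    (hA : ∀ z₀, AnalyticAt ℂ (A z₀) z₀) (hfA : ∀ z₀, f =ᶠ[𝓝[≠] z₀] A z₀) :
    ∃ F : ℂ → V, (∀ z₀, AnalyticAt ℂ F z₀) ∧ ∀ z₀, F =ᶠ[𝓝 z₀] A z₀ := by
  -- Near `z₀`, the extensions `A z` and `A z₀` are continuous at `z` and agree with `f` around it,
  -- so they have the same value at `z`.
  have key (z₀ : ℂ) : (fun z => A z z) =ᶠ[𝓝 z₀] A z₀ := by
    have h1 : ∀ᶠ z in 𝓝[≠] z₀, A z z = A z₀ z := by
      have h2 := eventually_eventually_nhdsWithin.2 (hfA z₀)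
      have h3 : ∀ᶠ z in 𝓝[≠] z₀, AnalyticAt ℂ (A z₀) z :=
        (hA z₀).eventually_analyticAt.filter_mono nhdsWithin_le_nhds
      filter_upwards [h2, h3, self_mem_nhdsWithin] with z hz han hne
      have hz' : f =ᶠ[𝓝[≠] z] A z₀ := by
        have : 𝓝[{z₀}ᶜ] z = 𝓝 z := isOpen_compl_singleton.nhdsWithin_eq hne
        rw [this] at hz
        exact hz.filter_mono nhdsWithin_le_nhds
      exact (((hA z).continuousAt.eventuallyEq_nhds_iff_eventuallyEq_nhdsNE
        han.continuousAt).1 ((hfA z).symm.trans hz')).eq_of_nhds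
    filter_upwards [eventually_nhdsWithin_iff.1 h1] with z hz
    by_cases hzz : z = z₀
    · rw [hzz]
    · exact hz hzz
  exact ⟨fun z => A z z, fun z₀ => (hA z₀).congr (key z₀).symm, key⟩

/-- An entire function whose growth at infinity is at most that of `z ^ n` is a polynomial. -/
theorem exists_eq_sum_of_growth {F T : ℂ → V} {n : ℕ}
    (hF : ∀ z, AnalyticAt ℂ F z) (hT : ContinuousAt T 0)
    (hFT : ∀ᶠ z in 𝓝[≠] (0 : ℂ), z ^ n • F z⁻¹ = T z) :
    ∃ v : ℕ → V, ∀ z, F z = ∑ k ∈ Finset.range (n + 1), z ^ k • v k := by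
  have hdiff : Differentiable ℂ F := fun z => (hF z).differentiableAt
  obtain ⟨C, hC⟩ : ∃ C, ∀ᶠ z in 𝓝 (0 : ℂ), ‖T z‖ ≤ C :=
    ⟨‖T 0‖ + 1, (hT.norm.eventually_lt continuousAt_const (by linarith)).mono fun _ h => h.le⟩
  have hev : ∀ᶠ z in 𝓝[≠] (0 : ℂ), ‖F z⁻¹‖ ≤ C * ‖z‖⁻¹ ^ n := by
    filter_upwards [hFT, hC.filter_mono nhdsWithin_le_nhds, self_mem_nhdsWithin] with z h1 h2 hz
    have hz : 0 < ‖z‖ := norm_pos_iff.2 hz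
    rw [← h1, norm_smul, norm_pow] at h2
    rw [inv_pow, ← div_eq_mul_inv, le_div_iff₀ (by positivity), mul_comm]
    exact h2
  obtain ⟨ε, hε, hball⟩ := Metric.mem_nhdsWithin_iff.1 hev
  have hbound (z : ℂ) (hz : ε⁻¹ < ‖z‖) : ‖F z‖ ≤ C * ‖z‖ ^ n := by
    have hz0 : 0 < ‖z‖ := (inv_pos.2 hε).trans hz
    have : z⁻¹ ∈ Metric.ball (0 : ℂ) ε ∩ {0}ᶜ := by
      refine ⟨?_, inv_ne_zero (norm_pos_iff.1 hz0)⟩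
      rw [mem_ball_zero_iff, norm_inv]
      exact inv_lt_of_inv_lt₀ hε hz
    simpa using hball this
  -- Cauchy's estimate on circles of radius tending to infinity.
  have hzero (k : ℕ) (hk : n < k) : iteratedDeriv k F 0 = 0 := by
    rw [← norm_le_zero_iff]
    have hlim : Filter.Tendsto (fun R : ℝ => k.factorial * C * (R ^ (k - n))⁻¹) Filter.atTop
        (𝓝 (k.factorial * C * 0)) :=
      ((Filter.tendsto_pow_atTop (by omega)).inv_tendsto_atTop).const_mul _
    rw [mul_zero] at hlim
    refine ge_of_tendsto hlim ?_
    filter_upwards [Filter.eventually_gt_atTop ε⁻¹] with R hR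
    have hR0 : 0 < R := (inv_pos.2 hε).trans hR
    have := Complex.norm_iteratedDeriv_le_of_forall_mem_sphere_norm_le (c := 0) k hR0
      hdiff.diffContOnCl (C := C * R ^ n) (fun z hz => by
        have hz : ‖z‖ = R := by simpa using hz
        rw [← hz]
        exact hbound z (hz ▸ hR))
    refine this.trans_eq ?_
    have : R ^ k = R ^ n * R ^ (k - n) := by rw [← pow_add]; congr 1; omega
    rw [this]
    field_simp
  refine ⟨fun k => (k.factorial : ℂ)⁻¹ • iteratedDeriv k F 0, fun z => ?_⟩
  rw [← Complex.taylorSeries_eq_of_entire hdiff 0 z, tsum_eq_sum (s := Finset.range (n + 1))]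
  · refine Finset.sum_congr rfl fun k _ => ?_
    rw [sub_zero, smul_comm]
  · intro k hk
    rw [hzero k (by simpa using hk)]
    simp

end Analysis

/-! ### The two affine charts and the polynomial lift of a curve. -/

section Chart

theorem affineParam_zero_eq_one {z : ℂ} (hz : z ≠ 0) : affineParam 0 z = affineParam 1 z⁻¹ := by
  rw [affineParam, affineParam, Projectivization.mk_eq_mk_iff']
  refine ⟨z, ?_⟩
  ext i
  fin_cases i <;> simp [hz]

theorem affineParam_zero_injective : Function.Injective (affineParam 0) := by
  intro z w h
  rw [affineParam, affineParam, Projectivization.mk_eq_mk_iff'] at h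
  obtain ⟨a, ha⟩ := h
  have h0 := congrFun ha 0
  have h1 := congrFun ha 1
  simp at h0 h1
  rw [← h1, h0, one_mul]

theorem affineParam_one_zero_ne (z : ℂ) : affineParam 1 0 ≠ affineParam 0 z := by
  intro h
  rw [affineParam, affineParam, Projectivization.mk_eq_mk_iff'] at h
  obtain ⟨a, ha⟩ := h
  have h0 := congrFun ha 0
  have h1 := congrFun ha 1
  simp at h0 h1
  simp [h0] at h1

theorem eq_affineParam (p : ProjLine) : p = affineParam 1 0 ∨ ∃ z, p = affineParam 0 z := by
  induction p using Projectivization.ind with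
  | h v hv =>
    by_cases h0 : v 0 = 0
    · left
      have h1 : v 1 ≠ 0 := fun h1 => hv (by ext i; fin_cases i <;> assumption)
      rw [affineParam, Projectivization.mk_eq_mk_iff']
      refine ⟨v 1, ?_⟩
      ext i
      fin_cases i <;> simp [h0]
    · right
      refine ⟨v 1 / v 0, ?_⟩
      rw [affineParam, Projectivization.mk_eq_mk_iff']
      refine ⟨v 0, ?_⟩
      ext i
      fin_cases i <;> simp
      field_simp

end Chart

namespace ProjCurve

variable {V : Type*} [NormedAddCommGroup V] [NormedSpace ℂ V]

/-- The representative of a point of `ℙ(V)` on which the functional `φ` takes the value `1`; this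
is `0` on the hyperplane `φ = 0`. -/
noncomputable def normalizedRep (φ : V →ₗ[ℂ] ℂ) (p : ℙ ℂ V) : V := (φ p.rep)⁻¹ • p.rep

theorem normalizedRep_mk (φ : V →ₗ[ℂ] ℂ) {v : V} (hv : v ≠ 0) :
    normalizedRep φ (Projectivization.mk ℂ v hv) = (φ v)⁻¹ • v := by
  obtain ⟨a, ha⟩ := Projectivization.exists_smul_eq_mk_rep ℂ v hv
  rw [normalizedRep, ← ha, Units.smul_def, map_smul, smul_smul, smul_eq_mul, mul_inv, mul_right_comm,
    inv_mul_cancel₀ a.ne_zero, one_mul]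

theorem submodule_mk_le_ker_iff (φ : V →ₗ[ℂ] ℂ) {v : V} (hv : v ≠ 0) :
    (Projectivization.mk ℂ v hv).submodule ≤ LinearMap.ker φ ↔ φ v = 0 := by
  rw [Projectivization.submodule_mk, Submodule.span_singleton_le_iff_mem, LinearMap.mem_ker]

variable {g : ProjLine → ℙ ℂ V} {i : Fin 2} {z₀ : ℂ} {G : ℂ → V}

theorem IsLocalLift.le_ker_iff (hG : IsLocalLift g i z₀ G) (φ : V →ₗ[ℂ] ℂ) :
    (g (affineParam i z₀)).submodule ≤ LinearMap.ker φ ↔ φ (G z₀) = 0 := by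
  obtain ⟨h, hg⟩ := hG.eq_mk.self_of_nhds
  rw [hg, submodule_mk_le_ker_iff]

theorem IsLocalLift.congr (hG : IsLocalLift g i z₀ G) {F : ℂ → V} (h : F =ᶠ[𝓝 z₀] G) :
    IsLocalLift g i z₀ F where
  analyticAt := hG.analyticAt.congr h.symm
  ne_zero := by rw [h.eq_of_nhds]; exact hG.ne_zero
  eq_mk := by
    filter_upwards [h, hG.eq_mk] with z hz hg
    rwa [hz]

theorem IsLocalLift.smul (hG : IsLocalLift g i z₀ G) {c : ℂ → ℂ} (hc : AnalyticAt ℂ c z₀)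
    (h0 : c z₀ ≠ 0) : IsLocalLift g i z₀ (fun z => c z • G z) where
  analyticAt := hc.smul hG.analyticAt
  ne_zero := smul_ne_zero h0 hG.ne_zero
  eq_mk := by
    filter_upwards [hG.eq_mk, hc.continuousAt.eventually_ne h0] with z ⟨h, hg⟩ hz
    refine ⟨smul_ne_zero hz h, ?_⟩
    rw [hg, Projectivization.mk_eq_mk_iff']
    exact ⟨(c z)⁻¹, inv_smul_smul₀ hz _⟩

open Classical in
/-- Near each of its points, a curve that is transverse to the hyperplane `φ = 0` is represented by
its normalized representative, multiplied by the coordinate if the point lies on the hyperplane. -/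
theorem exists_isLocalLift_normalizedRep [FiniteDimensional ℂ V] (hg : IsHolomorphic g)
    {φ : V →ₗ[ℂ] ℂ} (hφ : NowhereTangent g φ) (i : Fin 2) (z₀ : ℂ) :
    ∃ A : ℂ → V, IsLocalLift g i z₀ A ∧
      (¬ (g (affineParam i z₀)).submodule ≤ LinearMap.ker φ →
        normalizedRep φ (g (affineParam i z₀)) = A z₀) ∧
      ∀ᶠ z in 𝓝[≠] z₀,
      (if (g (affineParam i z₀)).submodule ≤ LinearMap.ker φ then z - z₀ else 1) •
        normalizedRep φ (g (affineParam i z)) = A z := by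
  obtain ⟨G, hG⟩ := hg i z₀
  have han : AnalyticAt ℂ (fun z => φ (G z)) z₀ :=
    (φ.toContinuousLinearMap.analyticAt _).comp hG.analyticAt
  have hderiv : deriv (fun z => φ (G z)) z₀ = φ (deriv G z₀) :=
    (φ.toContinuousLinearMap.hasFDerivAt.comp_hasDerivAt z₀
      hG.analyticAt.differentiableAt.hasDerivAt).deriv
  obtain ⟨c, hc, hc0, hcz₀, hcz⟩ := exists_analyticAt_inv han (by
    rw [hderiv]
    exact hφ.2 i z₀ G hG)
  refine ⟨_, hG.smul hc hc0, fun hmem => ?_, ?_⟩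
  · obtain ⟨h, hgz⟩ := hG.eq_mk.self_of_nhds
    rw [hG.le_ker_iff φ] at hmem
    rw [hgz, normalizedRep_mk, hcz₀ hmem]
  · filter_upwards [hcz, hG.eq_mk.filter_mono nhdsWithin_le_nhds] with z hz ⟨h, hgz⟩
    rw [hgz, normalizedRep_mk, smul_smul, ← hz]
    simp only [hG.le_ker_iff φ]

open Classical in
/-- The affine preimages of a hyperplane, counted together with the point at infinity. -/
theorem exists_finset_card {P : ProjLine → Prop} {d : ℕ} (h : {p | P p}.encard = d) :
    ∃ s : Finset ℂ, (∀ z, z ∈ s ↔ P (affineParam 0 z)) ∧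
      s.card + (if P (affineParam 1 0) then 1 else 0) = d := by
  have hfin : {z | P (affineParam 0 z)}.Finite :=
    (Set.finite_of_encard_eq_coe h).preimage affineParam_zero_injective.injOn
  refine ⟨hfin.toFinset, by simp, ?_⟩
  have hunion : {p | P p} = affineParam 0 '' {z | P (affineParam 0 z)} ∪
      (if P (affineParam 1 0) then {affineParam 1 0} else ∅) := by
    ext p
    rcases eq_affineParam p with rfl | ⟨z, rfl⟩
    · split_ifs with hp <;> simp [hp, (affineParam_one_zero_ne _).symm]
    · split_ifs with hp <;>
        simp [affineParam_zero_injective.eq_iff, (affineParam_one_zero_ne z).symm]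
  rw [hunion, Set.encard_union_eq, affineParam_zero_injective.encard_image,
    hfin.encard_eq_coe_toFinset_card] at h
  · split_ifs at h ⊢
    · rw [Set.encard_singleton] at h
      exact_mod_cast h
    · rw [Set.encard_empty] at h
      exact_mod_cast h
  · rw [Set.disjoint_left]
    rintro _ ⟨z, -, rfl⟩
    split_ifs <;> simp [(affineParam_one_zero_ne z).symm]

theorem prod_sub_inv (s : Finset ℂ) {z : ℂ} (hz : z ≠ 0) :
    z ^ s.card * ∏ a ∈ s, (z⁻¹ - a) = ∏ a ∈ s, (1 - a * z) := by
  rw [← Finset.prod_const, ← Finset.prod_mul_distrib]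
  refine Finset.prod_congr rfl fun a _ => ?_
  field_simp

open Classical in
theorem prod_sub_eq (s : Finset ℂ) (z₀ : ℂ) : ∃ p : ℂ → ℂ, AnalyticAt ℂ p z₀ ∧ p z₀ ≠ 0 ∧
    ∀ z, ∏ a ∈ s, (z - a) = p z * if z₀ ∈ s then z - z₀ else 1 := by
  refine ⟨fun z => ∏ a ∈ s.erase z₀, (z - a), ?_, ?_, fun z => ?_⟩
  · fun_prop
  · rw [Finset.prod_ne_zero_iff]
    intro a ha
    exact sub_ne_zero.2 (Finset.ne_of_mem_erase ha).symm
  · split_ifs with h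
    · rw [Finset.prod_erase_mul _ _ h]
    · rw [Finset.erase_eq_of_notMem h, mul_one]

/-- A holomorphic curve of degree `d` in `ℙ(V)` is given by a polynomial of degree at most `d`. -/
theorem exists_polynomial_lift [FiniteDimensional ℂ V] (hg : IsHolomorphic g) {d : ℕ}
    (hd : HasDegree g d) : ∃ v : ℕ → V,
      (∀ z, IsLocalLift g 0 z (fun z => ∑ k ∈ Finset.range (d + 1), z ^ k • v k)) ∧
      IsLocalLift g 1 0 (fun z => ∑ k ∈ Finset.range (d + 1), z ^ k • v (d - k)) := by
  classical
  have : CompleteSpace V := FiniteDimensional.complete ℂ V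
  obtain ⟨φ, hφ, hcard⟩ := hd
  obtain ⟨s, hs, hsd⟩ :=
    exists_finset_card (P := fun p => (g p).submodule ≤ LinearMap.ker φ) hcard
  -- The normalized representative has simple poles at the points of `s`, which the product cancels.
  set f : ℂ → V := fun z => (∏ a ∈ s, (z - a)) • normalizedRep φ (g (affineParam 0 z)) with hf
  have hlocal (z₀ : ℂ) : ∃ A, IsLocalLift g 0 z₀ A ∧ (z₀ ∉ s → f z₀ = A z₀) ∧
      f =ᶠ[𝓝[≠] z₀] A := by
    obtain ⟨A, hA, hAz₀, hAz⟩ := exists_isLocalLift_normalizedRep hg hφ 0 z₀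
    obtain ⟨p, hp, hp0, hpz⟩ := prod_sub_eq s z₀
    refine ⟨_, hA.smul hp hp0, fun hmem => ?_, ?_⟩
    · rw [hf, ← hAz₀ (by rwa [← hs])]
      simp [hpz, hmem]
    · filter_upwards [hAz] with z hz
      rw [hf, ← hz, smul_smul]
      simp only [hpz, hs]
  choose A hA hfA₀ hfA using hlocal
  obtain ⟨F, hF, hFA⟩ := exists_entire_of_forall_exists_analyticAt (fun z => (hA z).analyticAt) hfA
  have hlift (z : ℂ) : IsLocalLift g 0 z F := (hA z).congr (hFA z)
  have hFf : ∀ᶠ z in 𝓝[≠] (0 : ℂ), F z⁻¹ = f z⁻¹ := by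
    have hne : ∀ᶠ z in 𝓝[≠] (0 : ℂ), ∀ a ∈ s, 1 - a * z ≠ 0 := by
      rw [Filter.eventually_all_finset]
      intro a _
      have : ContinuousAt (fun z : ℂ => 1 - a * z) 0 := by fun_prop
      exact (this.eventually_ne (by simp)).filter_mono nhdsWithin_le_nhds
    filter_upwards [hne, self_mem_nhdsWithin] with z hz hz0
    have hz0 : z ≠ 0 := hz0
    have hmem : z⁻¹ ∉ s := fun h => hz _ h (by rw [inv_mul_cancel₀ hz0, sub_self])
    rw [hfA₀ _ hmem, (hFA z⁻¹).eq_of_nhds]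
  obtain ⟨T, hT, -, hTz⟩ := exists_isLocalLift_normalizedRep hg hφ 1 0
  -- `q` is the reversed product `z ^ s.card * ∏ (z⁻¹ - a)`. If infinity lies on the hyperplane, `d
  -- = s.card + 1` and the extra factor `z` cancels the pole there.
  set q : ℂ → ℂ := fun z => ∏ a ∈ s, (1 - a * z) with hq
  have hqa : AnalyticAt ℂ q 0 := by fun_prop
  have hT' := hT.smul hqa (by simp [hq])
  have hFT : ∀ᶠ z in 𝓝[≠] (0 : ℂ), z ^ d • F z⁻¹ = q z • T z := by
    filter_upwards [hFf, hTz, self_mem_nhdsWithin] with z h1 h2 hz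
    have hz : z ≠ 0 := hz
    rw [h1, ← h2, hf]
    simp only
    rw [affineParam_zero_eq_one (inv_ne_zero hz), inv_inv, smul_smul, smul_smul]
    congr 1
    rw [hq]
    simp only
    rw [← prod_sub_inv s hz, ← hsd, pow_add]
    split_ifs <;> simp
    ring
  obtain ⟨v, hv⟩ := exists_eq_sum_of_growth hF hT'.analyticAt.continuousAt hFT
  refine ⟨v, fun z => ?_, ?_⟩
  · rw [← funext hv]
    exact hlift z
  · refine hT'.congr ?_
    refine (ContinuousAt.eventuallyEq_nhds_iff_eventuallyEq_nhdsNE (by fun_prop)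
      hT'.analyticAt.continuousAt).1 ?_
    filter_upwards [hFT, self_mem_nhdsWithin] with z h1 hz
    have hz : z ≠ 0 := hz
    rw [← h1, hv, ← Finset.sum_range_reflect, Finset.smul_sum]
    refine Finset.sum_congr rfl fun k hk => ?_
    have hk : k ≤ d := Nat.lt_succ_iff.1 (Finset.mem_range.1 hk)
    rw [smul_smul, show d + 1 - 1 - k = d - k by omega, Nat.sub_sub_self hk, inv_pow,
      pow_sub₀ z hz hk]

end ProjCurve

theorem deriv_septic {V : Type*} [NormedAddCommGroup V] [NormedSpace ℂ V] (v : ℕ → V) (z : ℂ) :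
    deriv (septic v) z = septicDeriv v z := by
  have h (k : ℕ) : HasDerivAt (fun z : ℂ => z ^ k • v k) ((k * z ^ (k - 1)) • v k) z :=
    (hasDerivAt_pow k z).smul_const _
  have h2 : HasDerivAt (septic v) (∑ k ∈ Finset.range 8, ((k : ℂ) * z ^ (k - 1)) • v k) z :=
    HasDerivAt.fun_sum fun k _ => h k
  rw [h2.deriv, Finset.sum_range_succ']
  simp [septicDeriv]

/-! ### From null curves to coefficient data, and the conclusion. -/

namespace ProjCurve

variable {V : Type*} [NormedAddCommGroup V] [NormedSpace ℂ V]

theorem isNullSeptic_of_isLocalLift {B : LinearMap.BilinForm ℂ V} (hs : B.IsSymm)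
    {g : ProjLine → ℙ ℂ V} (hg : IsNullCurve B g) (hu : IsUnbranched g) {v : ℕ → V}
    (hv : ∀ z, IsLocalLift g 0 z (septic v)) (hv' : IsLocalLift g 1 0 (septic (septicRev v))) :
    IsNullSeptic B v (quotientCoeff fun i j => B (v i) (v j)) where
  symm i j := by rw [quotientCoeff, quotientCoeff, min_comm, max_comm]
  gram := by
    refine eq_gramCoeff_quotientCoeff (fun i j => hs.eq _ _) (fun z => ?_) (fun z => ?_)
    · rw [← hg.tangent_null 0 z _ (hv z) (septic v z) (Submodule.subset_span (by simp))]
      simp only [septic, map_sum, LinearMap.sum_apply, map_smul, LinearMap.smul_apply, smul_eq_mul,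
        Finset.mul_sum]
      rw [Finset.sum_comm]
      exact Finset.sum_congr rfl fun i _ => Finset.sum_congr rfl fun j _ => by ring
    · rw [← hg.tangent_null 0 z _ (hv z) (deriv (septic v) z) (Submodule.subset_span (by simp)),
        deriv_septic]
      simp only [septicDeriv, map_sum, LinearMap.sum_apply, map_smul, LinearMap.smul_apply,
        smul_eq_mul,
        Finset.mul_sum]
      rw [Finset.sum_comm]
      exact Finset.sum_congr rfl fun i _ => Finset.sum_congr rfl fun j _ => by ring
  indep z := by
    rw [← deriv_septic]
    exact hu 0 z _ (hv z)
  indep_top := by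
    have := hu 1 0 _ hv'
    rw [deriv_septic] at this
    simpa [septic, septicDeriv, septicRev, Finset.sum_range_succ] using this

theorem isLinear_of_mem_span {g : ProjLine → ℙ ℂ V} {v : ℕ → V}
    (hv : ∀ z, IsLocalLift g 0 z (septic v)) (hv' : IsLocalLift g 1 0 (septic (septicRev v)))
    (hli : LinearIndependent ℂ ![v 0, v 1])
    (hspan : ∀ k < 8, v k ∈ Submodule.span ℂ {v 0, v 1}) : IsLinear g := by
  refine ⟨Submodule.span ℂ {v 0, v 1}, ?_, fun p => ?_⟩
  · have hrange : Set.range ![v 0, v 1] = {v 0, v 1} := by simp [Set.pair_comm]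
    rw [← hrange, finrank_span_eq_card hli, Fintype.card_fin]
  · rcases eq_affineParam p with rfl | ⟨z, rfl⟩
    · obtain ⟨h, hg⟩ := hv'.eq_mk.self_of_nhds
      rw [hg, Projectivization.submodule_mk, Submodule.span_singleton_le_iff_mem]
      exact Submodule.sum_mem _ fun k hk => Submodule.smul_mem _ _ (hspan _ (by omega))
    · obtain ⟨h, hg⟩ := (hv z).eq_mk.self_of_nhds
      rw [hg, Projectivization.submodule_mk, Submodule.span_singleton_le_iff_mem]
      exact Submodule.sum_mem _ fun k hk =>
        Submodule.smul_mem _ _ (hspan _ (Finset.mem_range.1 hk))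

end ProjCurve

theorem mainTheorem1 (B : LinearMap.BilinForm ℂ (Fin 5 → ℂ)) (hsymm : B.IsSymm)
    (hnondeg : B.Nondegenerate) :
    ¬ ∃ g : ProjLine → ℙ ℂ (Fin 5 → ℂ),
      ProjCurve.IsNullCurve B g ∧ ¬ ProjCurve.IsLinear g ∧ ProjCurve.IsUnbranched g ∧
        ProjCurve.HasDegree g 7 := by
  rintro ⟨g, hg, hlin, hunb, hdeg⟩
  obtain ⟨v, hv, hv'⟩ := ProjCurve.exists_polynomial_lift hg.holomorphic hdeg
  have h := ProjCurve.isNullSeptic_of_isLocalLift hsymm hg hunb hv hv'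
  exact hlin (ProjCurve.isLinear_of_mem_span hv hv' h.indep_zero
    (h.mem_span (by simp) hsymm hnondeg))
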